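/- **Theorem.** Let $(X,\mu)$ be a standard probability space, and let $\mathrm{Aut}(\mu)$ be the group of its invertible measure-preserving transformations, identified when they agree almost everywhere. For $S\in\mathrm{Aut}(\mu)$ denote by the same letter the unitary operator $Sf(x)=f(Sx)$ on $L_2(X,\mu)$. For $T\in\mathrm{Aut}(\mu)$ the weakly homoclinic group of $T$ is $$WH(T)=\Big\{S\in\mathrm{Aut}(\mu)\;:\;\frac1N\sum_{i=1}^{N}T^{-i}ST^{i}\to I \text{ in the strong operator topology as } N\to\infty\Big\}.$$ The automorphism $T$ is mixing if $\mu(T^{-n}A\cap B)\to\mu(A)\mu(B)$ as $n\to\infty$ for all measurable $A,B$. It has rank $1$ if there is a sequence of measurable partitions $$\xi_j=\{E_j,\,TE_j,\,T^2E_j,\,\dots,\,T^{h_j-1}E_j,\,\tilde E_j\}$$ of $X$, with $h_j\ge 1$, such that every measurable set of finite measure is approximated in measure, to any given accuracy, by $\xi_j$-measurable sets (unions of elements of $\xi_j$) for all sufficiently large $j$. If $T$ is mixing and has rank $1$, then its weakly homoclinic group is trivial: $WH(T)=\{I\}$. -/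

import Mathlib

open MeasureTheory Filter Topology

noncomputable section

namespace RankOne

/-- An invertible measure preserving transformation of `(X, μ)`: a measurable bijection with
measurable inverse which preserves `μ`. -/
structure MPEquiv {X : Type*} [MeasurableSpace X] (μ : Measure X) where
  /-- the underlying bimeasurable bijection -/
  toEquiv : X ≃ᵐ X
  /-- it preserves the measure -/
  preserves : MeasurePreserving toEquiv μ μ

section Group

variable {X : Type*} [MeasurableSpace X] {μ : Measure X}

instance : CoeFun (MPEquiv μ) (fun _ => X → X) := ⟨fun S => S.toEquiv⟩

theorem MPEquiv.ext' {S R : MPEquiv μ} (h : ∀ x, S x = R x) : S = R := by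
  cases S; cases R
  congr
  exact MeasurableEquiv.ext (funext h)

/-- Invertible measure preserving transformations form a group under composition,
`(S * R) x = S (R x)`. -/
instance : Group (MPEquiv μ) where
  mul S R := ⟨R.toEquiv.trans S.toEquiv, S.preserves.comp R.preserves⟩
  one := ⟨MeasurableEquiv.refl X, MeasurePreserving.id μ⟩
  inv S := ⟨S.toEquiv.symm, S.preserves.symm S.toEquiv⟩
  mul_assoc _ _ _ := rfl
  one_mul _ := rfl
  mul_one _ := rfl
  inv_mul_cancel S := MPEquiv.ext' fun x => S.toEquiv.symm_apply_apply x

/-- Equality almost everywhere, as a congruence relation on the group of invertible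
measure preserving transformations. -/
def aeCon (μ : Measure X) : Con (MPEquiv μ) where
  r S R := (S : X → X) =ᵐ[μ] R
  iseqv := ⟨fun _ => EventuallyEq.rfl, fun h => h.symm, fun h h' => h.trans h'⟩
  mul' := by
    intro S S' R R' h h'
    have h1 : (S : X → X) ∘ R =ᵐ[μ] S' ∘ R := R.preserves.quasiMeasurePreserving.ae_eq_comp h
    have h2 : (S' : X → X) ∘ R =ᵐ[μ] S' ∘ R' := h'.fun_comp S'
    exact h1.trans h2

/-- The group `Aut(μ)` of automorphisms of the measure space `(X, μ)`: invertible measure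
preserving transformations, two of them being identified if they agree almost everywhere. -/
abbrev Aut (μ : Measure X) : Type _ := (aeCon μ).Quotient

/-- The unitary operator `f ↦ f ∘ S` on `L²(X, μ)` attached to an automorphism `S`. -/
def koopman (S : Aut μ) : Lp ℂ 2 μ →ₗᵢ[ℂ] Lp ℂ 2 μ :=
  Con.liftOn S (fun s => Lp.compMeasurePreservingₗᵢ ℂ s s.preserves) (by
    intro s r h
    ext1 f
    apply Subtype.ext
    exact AEEqFun.compMeasurePreserving_congr f.1 s.preserves r.toEquiv.measurable h)

theorem koopman_mul (S R : Aut μ) (f : Lp ℂ 2 μ) :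
    koopman (S * R) f = koopman R (koopman S f) := by
  induction S using Con.induction_on with | H s => ?_
  induction R using Con.induction_on with | H r => ?_
  exact Lp.compMeasurePreserving_comp_apply f s.preserves r.preserves

theorem koopman_one (f : Lp ℂ 2 μ) : koopman (1 : Aut μ) f = f :=
  Lp.compMeasurePreserving_id_apply f

/-- The operator `T⁻ⁱ S Tⁱ` on `L²(X, μ)`, where automorphisms are read as unitary operators. -/
def conjOp (T S : Aut μ) (i : ℕ) (f : Lp ℂ 2 μ) : Lp ℂ 2 μ :=
  koopman ((T⁻¹) ^ i) (koopman S (koopman (T ^ i) f))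

theorem conjOp_eq (T S : Aut μ) (i : ℕ) (f : Lp ℂ 2 μ) :
    conjOp T S i f = koopman (T ^ i * S * (T ^ i)⁻¹) f := by
  rw [conjOp, koopman_mul, koopman_mul, inv_pow]

/-- The Cesàro averages `(1/N) ∑_{i=1}^N T⁻ⁱ S Tⁱ` converge strongly to the identity. -/
def IsWeaklyHomoclinic (T S : Aut μ) : Prop :=
  ∀ f : Lp ℂ 2 μ,
    Tendsto (fun N : ℕ => (1 / (N : ℂ)) • ∑ i ∈ Finset.Icc 1 N, conjOp T S i f) atTop (𝓝 f)

theorem norm_conjOp (T S : Aut μ) (i : ℕ) (f : Lp ℂ 2 μ) : ‖conjOp T S i f‖ = ‖f‖ := by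
  rw [conjOp_eq, LinearIsometry.norm_map]

theorem isWeaklyHomoclinic_iff (T S : Aut μ) :
    IsWeaklyHomoclinic T S ↔ ∀ f : Lp ℂ 2 μ,
      Tendsto (fun N : ℕ => (1 / (N : ℝ)) * ∑ i ∈ Finset.Icc 1 N, ‖conjOp T S i f - f‖ ^ 2)
        atTop (𝓝 0) := by
  refine forall_congr' fun f => ⟨fun h => ?_, fun h => ?_⟩
  · have h1 : Tendsto (fun N : ℕ => 2 * ‖f‖ ^ 2 - 2 * RCLike.re (inner ℂ
        ((1 / (N : ℂ)) • ∑ i ∈ Finset.Icc 1 N, conjOp T S i f) f)) atTop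
        (𝓝 (2 * ‖f‖ ^ 2 - 2 * RCLike.re (inner ℂ f f))) :=
      tendsto_const_nhds.sub
        ((((RCLike.continuous_re (K := ℂ)).tendsto _).comp
          (h.inner tendsto_const_nhds)).const_mul 2)
    rw [inner_self_eq_norm_sq, sub_self] at h1
    refine h1.congr' ?_
    filter_upwards [eventually_ge_atTop 1] with N hN
    have hN' : (N : ℝ) ≠ 0 := by positivity
    have h2 : ∀ i, ‖conjOp T S i f - f‖ ^ 2
        = 2 * ‖f‖ ^ 2 - 2 * RCLike.re (inner ℂ (conjOp T S i f) f) := by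
      intro i
      rw [norm_sub_sq (𝕜 := ℂ), norm_conjOp]
      ring
    have h3 : (1 / (N : ℂ)) = ((1 / (N : ℝ) : ℝ) : ℂ) := by push_cast; rfl
    rw [Finset.sum_congr rfl fun i _ => h2 i, Finset.sum_sub_distrib, ← Finset.mul_sum, h3,
      inner_smul_left, sum_inner, Complex.conj_ofReal]
    simp only [RCLike.re_to_complex, Complex.re_ofReal_mul, Complex.re_sum, Finset.sum_const,
      Nat.card_Icc, add_tsub_cancel_right, nsmul_eq_mul, ← Finset.mul_sum]
    field_simp
  · rw [tendsto_iff_norm_sub_tendsto_zero]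
    have h1 : Tendsto (fun N : ℕ => √((1 / (N : ℝ)) *
        ∑ i ∈ Finset.Icc 1 N, ‖conjOp T S i f - f‖ ^ 2)) atTop (𝓝 0) := by
      simpa using h.sqrt
    refine squeeze_zero' (Eventually.of_forall fun _ => norm_nonneg _) ?_ h1
    filter_upwards [eventually_ge_atTop 1] with N hN
    have hN' : (0 : ℝ) < N := by positivity
    have hN'' : (N : ℂ) ≠ 0 := by exact_mod_cast hN'.ne'
    apply Real.le_sqrt_of_sq_le
    have h2 : (1 / (N : ℂ)) • ∑ i ∈ Finset.Icc 1 N, conjOp T S i f - f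
        = (1 / (N : ℂ)) • ∑ i ∈ Finset.Icc 1 N, (conjOp T S i f - f) := by
      rw [Finset.sum_sub_distrib, smul_sub, Finset.sum_const, Nat.card_Icc,
        add_tsub_cancel_right, ← Nat.cast_smul_eq_nsmul ℂ, smul_smul, one_div,
        inv_mul_cancel₀ hN'', one_smul]
    have h3 : ‖(1 / (N : ℂ)) • ∑ i ∈ Finset.Icc 1 N, conjOp T S i f - f‖
        ≤ (1 / (N : ℝ)) * ∑ i ∈ Finset.Icc 1 N, ‖conjOp T S i f - f‖ := by
      rw [h2, norm_smul, norm_div, norm_one, Complex.norm_natCast]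
      gcongr
      exact norm_sum_le _ _
    have h4 := sq_sum_le_card_mul_sum_sq (s := Finset.Icc 1 N)
      (f := fun i => ‖conjOp T S i f - f‖)
    rw [Nat.card_Icc, add_tsub_cancel_right] at h4
    calc _ ≤ ((1 / (N : ℝ)) * ∑ i ∈ Finset.Icc 1 N, ‖conjOp T S i f - f‖) ^ 2 := by gcongr
      _ = (1 / (N : ℝ)) ^ 2 * (∑ i ∈ Finset.Icc 1 N, ‖conjOp T S i f - f‖) ^ 2 := mul_pow _ _ _
      _ ≤ (1 / (N : ℝ)) ^ 2 * (N * ∑ i ∈ Finset.Icc 1 N, ‖conjOp T S i f - f‖ ^ 2) := by gcongr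
      _ = _ := by field_simp

/-- The weakly homoclinic group
`WH(T) = {S ∈ Aut(μ) : (1/N) ∑_{i=1}^N T⁻ⁱ S Tⁱ → I strongly as N → ∞}`. -/
def WH (T : Aut μ) : Subgroup (Aut μ) where
  carrier := {S | IsWeaklyHomoclinic T S}
  one_mem' := by
    rw [Set.mem_ofPred_eq, isWeaklyHomoclinic_iff]
    intro f
    simp [conjOp_eq, koopman_one]
  inv_mem' := by
    intro S hS
    rw [Set.mem_ofPred_eq, isWeaklyHomoclinic_iff] at hS ⊢
    intro f
    refine (hS f).congr fun N => ?_
    congr 1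
    refine Finset.sum_congr rfl fun i _ => ?_
    rw [conjOp_eq, conjOp_eq, ← LinearIsometry.norm_map (koopman (T ^ i * S * (T ^ i)⁻¹))
      (koopman (T ^ i * S⁻¹ * (T ^ i)⁻¹) f - f), map_sub, ← koopman_mul]
    have : T ^ i * S⁻¹ * (T ^ i)⁻¹ * (T ^ i * S * (T ^ i)⁻¹) = 1 := by group
    rw [this, koopman_one, norm_sub_rev]
  mul_mem' := by
    intro S R hS hR
    rw [Set.mem_ofPred_eq, isWeaklyHomoclinic_iff] at hS hR ⊢
    intro f
    have h := ((hS f).add (hR f)).const_mul 2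
    rw [add_zero, mul_zero] at h
    refine squeeze_zero (fun N => by positivity) (fun N => ?_) h
    have e0 : 2 * ((1 / (N : ℝ)) * ∑ i ∈ Finset.Icc 1 N, ‖conjOp T S i f - f‖ ^ 2
        + (1 / (N : ℝ)) * ∑ i ∈ Finset.Icc 1 N, ‖conjOp T R i f - f‖ ^ 2)
        = (1 / (N : ℝ)) * ∑ i ∈ Finset.Icc 1 N,
          2 * (‖conjOp T S i f - f‖ ^ 2 + ‖conjOp T R i f - f‖ ^ 2) := by
      rw [← Finset.mul_sum, Finset.sum_add_distrib]
      ring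
    rw [e0]
    refine mul_le_mul_of_nonneg_left (Finset.sum_le_sum fun i _ => ?_) (by positivity)
    have e : conjOp T (S * R) i f - f = koopman (T ^ i * R * (T ^ i)⁻¹) (conjOp T S i f - f)
        + (conjOp T R i f - f) := by
      rw [map_sub, conjOp_eq, conjOp_eq, conjOp_eq, ← koopman_mul]
      have : T ^ i * S * (T ^ i)⁻¹ * (T ^ i * R * (T ^ i)⁻¹) = T ^ i * (S * R) * (T ^ i)⁻¹ := by
        group
      rw [this]
      abel
    have h1 : ‖conjOp T (S * R) i f - f‖ ≤ ‖conjOp T S i f - f‖ + ‖conjOp T R i f - f‖ := by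
      rw [e]
      refine (norm_add_le _ _).trans ?_
      rw [LinearIsometry.norm_map]
    calc _ ≤ (‖conjOp T S i f - f‖ + ‖conjOp T R i f - f‖) ^ 2 := by gcongr
      _ ≤ _ := add_sq_le

end Group

section Dynamics

variable {X : Type*} [MeasurableSpace X]

/-- Mixing: `μ(T⁻ⁿA ∩ B) → μ(A) μ(B)` for all measurable `A`, `B`. -/
def IsMixing (μ : Measure X) (T : X → X) : Prop :=
  ∀ A B : Set X, MeasurableSet A → MeasurableSet B →
    Tendsto (fun n : ℕ => μ (T^[n] ⁻¹' A ∩ B)) atTop (𝓝 (μ A * μ B))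

/-- The levels `E, TE, …, T^{h-1}E` of the tower of height `h` over `E`. -/
def towerLevels (T : X → X) (E : Set X) (h : ℕ) : Set (Set X) :=
  {L | ∃ i < h, L = T^[i] '' E}

/-- The atoms of the partition `{E, TE, …, T^{h-1}E, Ẽ}`, where `Ẽ` is the complement of the
union of the tower. -/
def towerPartition (T : X → X) (E : Set X) (h : ℕ) : Set (Set X) :=
  towerLevels T E h ∪ {(⋃₀ towerLevels T E h)ᶜ}

/-- `T` has rank one: there are towers with bases `E j` and heights `h j`, each with disjoint
levels, such that for every measurable `A` (of finite measure) and every `ε > 0`, for all large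
`j` some union of atoms of the `j`-th partition approximates `A` up to measure `ε`. -/
def HasRankOne (μ : Measure X) (T : X → X) : Prop :=
  ∃ (E : ℕ → Set X) (h : ℕ → ℕ),
    (∀ j, MeasurableSet (E j)) ∧
    (∀ j, 0 < h j) ∧
    (∀ j, ∀ i < h j, ∀ k < h j, i ≠ k → Disjoint (T^[i] '' E j) (T^[k] '' E j)) ∧
    ∀ A : Set X, MeasurableSet A → μ A < ⊤ → ∀ ε : ENNReal, 0 < ε →
      ∀ᶠ j in atTop, ∃ 𝒮 ⊆ towerPartition T (E j) (h j), μ (symmDiff A (⋃₀ 𝒮)) < ε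

end Dynamics

end RankOne

end

/-! Let `S` be weakly homoclinic and fix `A` with 0 < μ(A) < 1. On average over n ≤ N the set T⁻ⁿA
is almost `S`-invariant, so for most x the orbits of x and Sx agree about `A` at most times up to N.
In a tall tower this forces Sx into the level of x. If x and Sx lay in levels k < l, with N more
levels above l, their disagreements would be counted by the levels k+1, …, k+N that meet A ∩ T⁻ᵈAᶜ,
where d = l − k. The union W of these levels is almost invariant, as only its top level leaves it,
so mixing makes W nearly independent of A ∩ T⁻ᵈAᶜ. That set has measure at least some c > 0 for all
d ≥ 1, so a fixed proportion of the times would be disagreements. Hence `S` preserves most levels,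
almost preserves every set approximated by unions of levels, and is the identity.

The difficulty is uniformity in d, since d may grow with the tower. It is settled by
`IsMixing.exists_uniform_decorrelation` and `IsMixing.exists_uniform_lower_bound`; the count of
disagreements is `le_mismatches_mul_of_lt`, and `IsWeaklyHomoclinic.ae_eq_id` combines everything.
-/

namespace RankOne

/-! ### Mixing estimates, uniform in the displacement d. -/

section Mixing

variable {X : Type*} [MeasurableSpace X] {μ : Measure X} {T : X → X}

theorem measureReal_preimage_iterate (hT : MeasurePreserving T μ μ) {A : Set X}
    (hA : MeasurableSet A) (n : ℕ) : μ.real (T^[n] ⁻¹' A) = μ.real A :=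
  (hT.iterate n).measureReal_preimage hA.nullMeasurableSet

theorem measureReal_preimage_inter_preimage_of_le (hT : MeasurePreserving T μ μ) {A B : Set X}
    (hA : MeasurableSet A) (hB : MeasurableSet B) {m n : ℕ} (h : m ≤ n) :
    μ.real (T^[m] ⁻¹' A ∩ T^[n] ⁻¹' B) = μ.real (A ∩ T^[n - m] ⁻¹' B) := by
  have h1 : T^[m] ⁻¹' A ∩ T^[n] ⁻¹' B = T^[m] ⁻¹' (A ∩ T^[n - m] ⁻¹' B) := by
    rw [Set.preimage_inter, ← Set.preimage_comp, ← Function.iterate_add, Nat.sub_add_cancel h]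
  rw [h1, measureReal_preimage_iterate hT (hA.inter ((hT.iterate _).measurable hB))]

variable [IsProbabilityMeasure μ]

/-- Blum–Hanson type variance estimate: if the correlations of `B` along the multiples of `s`
are at most `ε` above `μ(B)²`, then the variance of the visits to `B` is small. -/
theorem integral_sq_sum_indicator_le (hT : MeasurePreserving T μ μ) {B : Set X}
    (hB : MeasurableSet B) (L s : ℕ) {ε : ℝ} (hε : 0 ≤ ε)
    (h : ∀ i, 1 ≤ i → i < L → μ.real (B ∩ T^[i * s] ⁻¹' B) ≤ μ.real B ^ 2 + ε) :
    ∫ x, (∑ n ∈ Finset.range L, ((T^[n * s] ⁻¹' B).indicator 1 x - μ.real B)) ^ 2 ∂μ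
      ≤ L + L ^ 2 * ε := by
  have hm (n : ℕ) : MeasurableSet (T^[n * s] ⁻¹' B) := (hT.iterate _).measurable hB
  have hi (n : ℕ) : Integrable ((T^[n * s] ⁻¹' B).indicator (1 : X → ℝ)) μ :=
    (integrable_const (1 : ℝ)).indicator (hm n)
  have hprod (n m : ℕ) (x : X) :
      ((T^[n * s] ⁻¹' B).indicator 1 x - μ.real B) * ((T^[m * s] ⁻¹' B).indicator 1 x - μ.real B)
      = (T^[n * s] ⁻¹' B ∩ T^[m * s] ⁻¹' B).indicator (1 : X → ℝ) x
        - μ.real B * (T^[n * s] ⁻¹' B).indicator 1 x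
        - μ.real B * (T^[m * s] ⁻¹' B).indicator 1 x + μ.real B ^ 2 := by
    rw [Set.inter_indicator_one]
    simp only [Pi.mul_apply]
    ring
  have hi2 (n m : ℕ) : Integrable ((T^[n * s] ⁻¹' B ∩ T^[m * s] ⁻¹' B).indicator (1 : X → ℝ)) μ :=
    (integrable_const (1 : ℝ)).indicator ((hm n).inter (hm m))
  have hip (n m : ℕ) : Integrable (fun x => ((T^[n * s] ⁻¹' B).indicator 1 x - μ.real B) *
      ((T^[m * s] ⁻¹' B).indicator 1 x - μ.real B)) μ := by
    simp only [hprod]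
    exact (((hi2 n m).sub ((hi n).const_mul _)).sub ((hi m).const_mul _)).add (integrable_const _)
  have hcov (n m : ℕ) : ∫ x, ((T^[n * s] ⁻¹' B).indicator 1 x - μ.real B) *
      ((T^[m * s] ⁻¹' B).indicator 1 x - μ.real B) ∂μ
      = μ.real (T^[n * s] ⁻¹' B ∩ T^[m * s] ⁻¹' B) - μ.real B ^ 2 := by
    simp only [hprod]
    have hc (k : ℕ) : Integrable (fun x => μ.real B * (T^[k * s] ⁻¹' B).indicator 1 x) μ :=
      (hi k).const_mul _
    have h1 : Integrable (fun x => (T^[n * s] ⁻¹' B ∩ T^[m * s] ⁻¹' B).indicator (1 : X → ℝ) x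
        - μ.real B * (T^[n * s] ⁻¹' B).indicator 1 x) μ := (hi2 n m).sub (hc n)
    have h2 : Integrable (fun x => (T^[n * s] ⁻¹' B ∩ T^[m * s] ⁻¹' B).indicator (1 : X → ℝ) x
        - μ.real B * (T^[n * s] ⁻¹' B).indicator 1 x
        - μ.real B * (T^[m * s] ⁻¹' B).indicator 1 x) μ := h1.sub (hc m)
    rw [integral_add h2 (integrable_const _), integral_sub h1 (hc m), integral_sub (hi2 n m) (hc n),
      integral_const_mul, integral_const_mul, integral_indicator_one ((hm n).inter (hm m)),
      integral_indicator_one (hm n), integral_indicator_one (hm m),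
      measureReal_preimage_iterate hT hB, measureReal_preimage_iterate hT hB]
    simp
    ring
  -- By invariance the correlation depends only on the gap (m − n)s.
  have hlt {n m : ℕ} (hnm : n < m) (hmL : m < L) :
      μ.real (T^[n * s] ⁻¹' B ∩ T^[m * s] ⁻¹' B) ≤ μ.real B ^ 2 + ε := by
    rw [measureReal_preimage_inter_preimage_of_le hT hB hB (Nat.mul_le_mul_right s hnm.le),
      ← Nat.sub_mul]
    exact h _ (by omega) (by omega)
  have hterm (n : ℕ) (hn : n ∈ Finset.range L) (m : ℕ) (hmL : m ∈ Finset.range L) :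
      μ.real (T^[n * s] ⁻¹' B ∩ T^[m * s] ⁻¹' B) - μ.real B ^ 2
        ≤ (if n = m then 1 else 0) + ε := by
    rw [Finset.mem_range] at hn hmL
    rcases lt_trichotomy n m with h1 | h1 | h1
    · rw [if_neg h1.ne]
      linarith [hlt h1 hmL]
    · rw [if_pos h1]
      have := measureReal_le_one (μ := μ) (s := T^[n * s] ⁻¹' B ∩ T^[m * s] ⁻¹' B)
      nlinarith [sq_nonneg (μ.real B)]
    · rw [if_neg h1.ne', Set.inter_comm]
      linarith [hlt h1 hn]
  simp only [sq (Finset.sum _ _), Finset.sum_mul_sum]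
  rw [integral_finsetSum _ fun n _ => integrable_finsetSum _ fun m _ => hip n m]
  simp only [integral_finsetSum _ fun m _ => hip _ m, hcov]
  calc _ ≤ ∑ n ∈ Finset.range L, ∑ m ∈ Finset.range L, ((if n = m then (1 : ℝ) else 0) + ε) :=
        Finset.sum_le_sum fun n hn => Finset.sum_le_sum fun m hm => hterm n hn m hm
    _ = L + L ^ 2 * ε := by
        have (n : ℕ) (hn : n ∈ Finset.range L) :
            ∑ m ∈ Finset.range L, ((if n = m then (1 : ℝ) else 0) + ε) = 1 + L * ε := by
          rw [Finset.sum_add_distrib, Finset.sum_ite_eq, if_pos hn]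
          simp
        rw [Finset.sum_congr rfl this]
        simp
        ring

/-- By invariance, every step of the orbit loses at most what the first step loses. -/
theorem measureReal_diff_preimage_iterate_le (hT : MeasurePreserving T μ μ) {W : Set X}
    (hW : MeasurableSet W) (n : ℕ) :
    μ.real (W \ T^[n] ⁻¹' W) ≤ n * μ.real (W \ T ⁻¹' W) := by
  induction n with
  | zero => simp
  | succ n ih =>
    have hsub : W \ T^[n + 1] ⁻¹' W ⊆ (W \ T^[n] ⁻¹' W) ∪ T^[n] ⁻¹' (W \ T ⁻¹' W) := by
      intro x hx
      rw [Function.iterate_succ'] at hx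
      by_cases h : T^[n] x ∈ W
      · exact Or.inr ⟨h, hx.2⟩
      · exact Or.inl ⟨hx.1, h⟩
    have h1 := measureReal_preimage_iterate hT (hW.diff (hT.measurable hW)) n
    have h2 := (measureReal_mono (μ := μ) hsub).trans (measureReal_union_le _ _)
    push_cast
    linarith

/-- Lower bound for the measure of `W ∩ B` when `W` is almost invariant and `B` is almost
uncorrelated with its translates. -/
theorem le_measureReal_inter_of_correlations (hT : MeasurePreserving T μ μ) {B W : Set X}
    (hB : MeasurableSet B) (hW : MeasurableSet W) {L : ℕ} (hL : 0 < L) (s : ℕ) {ε θ : ℝ}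
    (hε : 0 ≤ ε) (hθ : 0 < θ)
    (h : ∀ i, 1 ≤ i → i < L → μ.real (B ∩ T^[i * s] ⁻¹' B) ≤ μ.real B ^ 2 + ε) :
    μ.real W * μ.real B - L * s * μ.real (W \ T ⁻¹' W) - θ - (1 / L + ε) / θ
      ≤ μ.real (W ∩ B) := by
  have hL' : (0 : ℝ) < L := by exact_mod_cast hL
  have hm (n : ℕ) : MeasurableSet (T^[n * s] ⁻¹' B) := (hT.iterate _).measurable hB
  have hi (n : ℕ) : Integrable
      (fun x => (T^[n * s] ⁻¹' B).indicator (1 : X → ℝ) x - μ.real B) μ :=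
    ((integrable_const (1 : ℝ)).indicator (hm n)).sub (integrable_const _)
  set Y : X → ℝ := fun x => ∑ n ∈ Finset.range L, ((T^[n * s] ⁻¹' B).indicator 1 x - μ.real B)
    with hY
  have hYi : Integrable Y μ := integrable_finsetSum _ fun n _ => hi n
  have hYm : Measurable Y := Finset.measurable_sum _ fun n _ =>
    (measurable_one.indicator (hm n)).sub_const _
  have hYb (x : X) : |Y x| ≤ L := by
    refine (Finset.abs_sum_le_sum_abs _ _).trans ?_
    calc _ ≤ ∑ n ∈ Finset.range L, (1 : ℝ) := Finset.sum_le_sum fun n _ => ?_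
      _ = L := by simp
    have h0 := measureReal_nonneg (μ := μ) (s := B)
    have h1 := measureReal_le_one (μ := μ) (s := B)
    by_cases hx : x ∈ T^[n * s] ⁻¹' B
    · rw [Set.indicator_of_mem hx, Pi.one_apply, abs_le]
      constructor <;> linarith
    · rw [Set.indicator_of_notMem hx, abs_le]
      constructor <;> linarith
  have hY2i : Integrable (fun x => Y x ^ 2) μ := by
    refine Integrable.of_bound (hYm.pow_const 2).aestronglyMeasurable ((L : ℝ) ^ 2)
      (Eventually.of_forall fun x => ?_)
    rw [Real.norm_eq_abs, abs_pow]
    exact pow_le_pow_left₀ (abs_nonneg _) (hYb x) 2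
  have hvar : ∫ x, Y x ^ 2 ∂μ ≤ L + L ^ 2 * ε := integral_sq_sum_indicator_le hT hB L s hε h
  -- The bound |y| ≤ a + y²/a with a = θL stands in for Cauchy–Schwarz and keeps `θ` free.
  have hpt (x : X) : -(θ * L + 1 / (θ * L) * Y x ^ 2) ≤ W.indicator Y x := by
    have hc : 0 < θ * L := by positivity
    have key : |Y x| ≤ θ * L + 1 / (θ * L) * Y x ^ 2 := by
      rw [← sq_abs (Y x)]
      have : 0 ≤ (θ * L - |Y x|) ^ 2 + (θ * L) * |Y x| := by positivity
      rw [← sub_nonneg]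
      have e : θ * L + 1 / (θ * L) * |Y x| ^ 2 - |Y x|
          = ((θ * L - |Y x|) ^ 2 + (θ * L) * |Y x|) / (θ * L) := by
        field_simp
        ring
      rw [e]
      positivity
    by_cases hx : x ∈ W
    · rw [Set.indicator_of_mem hx]
      linarith [neg_abs_le (Y x)]
    · rw [Set.indicator_of_notMem hx]
      linarith [abs_nonneg (Y x)]
  have hint : -(θ * L + 1 / (θ * L) * (L + L ^ 2 * ε)) ≤ ∫ x in W, Y x ∂μ := by
    rw [← integral_indicator hW]
    have hi3 : Integrable (fun x => θ * L + 1 / (θ * L) * Y x ^ 2) μ :=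
      (integrable_const _).add (hY2i.const_mul _)
    have h1 : ∫ x, -(θ * L + 1 / (θ * L) * Y x ^ 2) ∂μ ≤ ∫ x, W.indicator Y x ∂μ :=
      integral_mono hi3.neg (hYi.indicator hW) hpt
    rw [integral_neg, integral_add (integrable_const _) (hY2i.const_mul _),
      integral_const_mul (1 / (θ * L))] at h1
    simp only [integral_const, probReal_univ, one_smul] at h1
    have h2 : 1 / (θ * L) * ∫ x, Y x ^ 2 ∂μ ≤ 1 / (θ * L) * (L + L ^ 2 * ε) := by gcongr
    linarith
  have hsum : ∫ x in W, Y x ∂μ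
      = ∑ n ∈ Finset.range L, (μ.real (W ∩ T^[n * s] ⁻¹' B) - μ.real W * μ.real B) := by
    rw [hY, integral_finsetSum _ fun n _ => (hi n).integrableOn]
    refine Finset.sum_congr rfl fun n _ => ?_
    have h1 : IntegrableOn (fun x => (T^[n * s] ⁻¹' B).indicator (1 : X → ℝ) x) W μ :=
      ((integrable_const (1 : ℝ)).indicator (hm n)).integrableOn
    rw [integral_sub h1 (integrable_const _).integrableOn, integral_indicator_one (hm n),
      measureReal_restrict_apply (hm n), setIntegral_const, Set.inter_comm]
    rfl
  -- Almost invariance of `W` lets T⁻ⁿˢB be pulled back to `B`.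
  have hstep (n : ℕ) (hn : n ∈ Finset.range L) :
      μ.real (W ∩ T^[n * s] ⁻¹' B) ≤ μ.real (W ∩ B) + L * s * μ.real (W \ T ⁻¹' W) := by
    have hsub : W ∩ T^[n * s] ⁻¹' B ⊆ T^[n * s] ⁻¹' (W ∩ B) ∪ (W \ T^[n * s] ⁻¹' W) := by
      intro x hx
      by_cases hxW : T^[n * s] x ∈ W
      · exact Or.inl ⟨hxW, hx.2⟩
      · exact Or.inr ⟨hx.1, hxW⟩
    have h1 := (measureReal_mono (μ := μ) hsub).trans (measureReal_union_le _ _)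
    rw [measureReal_preimage_iterate hT (hW.inter hB)] at h1
    have h2 := measureReal_diff_preimage_iterate_le hT hW (n * s)
    have h3 : ((n * s : ℕ) : ℝ) * μ.real (W \ T ⁻¹' W) ≤ L * s * μ.real (W \ T ⁻¹' W) := by
      have : (n : ℝ) ≤ L := by exact_mod_cast (Finset.mem_range.1 hn).le
      push_cast
      gcongr
    linarith
  have hfin : ∫ x in W, Y x ∂μ ≤ L * (μ.real (W ∩ B) + L * s * μ.real (W \ T ⁻¹' W)
      - μ.real W * μ.real B) := by
    rw [hsum]
    calc _ ≤ ∑ n ∈ Finset.range L, (μ.real (W ∩ B) + L * s * μ.real (W \ T ⁻¹' W)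
          - μ.real W * μ.real B) :=
          Finset.sum_le_sum fun n hn => by linarith [hstep n hn]
      _ = _ := by rw [Finset.sum_const, Finset.card_range, nsmul_eq_mul]
  have e : θ * L + 1 / (θ * L) * (L + L ^ 2 * ε) = L * (θ + (1 / L + ε) / θ) := by
    field_simp
  rw [e] at hint
  have h4 := hint.trans hfin
  rw [← mul_neg] at h4
  have := le_of_mul_le_mul_left h4 hL'
  linarith

theorem IsMixing.tendsto_real (hmix : IsMixing μ T) {A B : Set X} (hA : MeasurableSet A)
    (hB : MeasurableSet B) :
    Tendsto (fun n : ℕ => μ.real (A ∩ T^[n] ⁻¹' B)) atTop (𝓝 (μ.real A * μ.real B)) := by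
  have h := (ENNReal.tendsto_toReal (by finiteness)).comp (hmix B A hB hA)
  rw [ENNReal.toReal_mul, mul_comm] at h
  refine h.congr fun n => ?_
  simp only [Function.comp_apply, Measure.real, Set.inter_comm]

/-- The sets `A ∩ T⁻ᵈ C` are almost uncorrelated along multiples of some `s`, bounded
uniformly in `d`. -/
theorem IsMixing.exists_uniform_decorrelation (hT : MeasurePreserving T μ μ)
    (hmix : IsMixing μ T) {A C : Set X} (hA : MeasurableSet A) (hC : MeasurableSet C)
    (L : ℕ) {ε : ℝ} (hε : 0 < ε) :
    ∃ M : ℕ, ∀ d : ℕ, ∃ s ≤ M, ∀ i, 1 ≤ i → i < L →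
      μ.real ((A ∩ T^[d] ⁻¹' C) ∩ T^[i * s] ⁻¹' (A ∩ T^[d] ⁻¹' C))
        ≤ μ.real (A ∩ T^[d] ⁻¹' C) ^ 2 + ε := by
  have hp (n : ℕ) {D : Set X} (hD : MeasurableSet D) : MeasurableSet (T^[n] ⁻¹' D) :=
    (hT.iterate n).measurable hD
  have hB (d : ℕ) : MeasurableSet (A ∩ T^[d] ⁻¹' C) := hA.inter (hp d hC)
  -- `s₀` is fixed before d. The step used for large d is `s₀ + 1`, all of whose positive multiples
  -- exceed `s₀`.
  obtain ⟨s₀, hs₀⟩ : ∃ s₀ : ℕ, ∀ s ≥ s₀,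
      μ.real (A ∩ T^[s] ⁻¹' A) * μ.real (C ∩ T^[s] ⁻¹' C)
        < (μ.real A * μ.real C) ^ 2 + ε / 2 := by
    have h := (hmix.tendsto_real hA hA).mul (hmix.tendsto_real hC hC)
    exact eventually_atTop.1 (h.eventually_lt_const (by nlinarith))
  -- Regrouped as (A ∩ T⁻ⁱˢA) ∩ T⁻ᵈ(C ∩ T⁻ⁱˢC), with s = `s₀ + 1`, the fourfold intersection needs
  -- only twofold mixing as d → ∞.
  have hlim (i : ℕ) : Tendsto (fun d : ℕ =>
      μ.real ((A ∩ T^[d] ⁻¹' C) ∩ T^[i * (s₀ + 1)] ⁻¹' (A ∩ T^[d] ⁻¹' C)) -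
        μ.real (A ∩ T^[d] ⁻¹' C) ^ 2) atTop
      (𝓝 (μ.real (A ∩ T^[i * (s₀ + 1)] ⁻¹' A) * μ.real (C ∩ T^[i * (s₀ + 1)] ⁻¹' C)
        - (μ.real A * μ.real C) ^ 2)) := by
    refine ((hmix.tendsto_real (hA.inter (hp _ hA)) (hC.inter (hp _ hC))).congr fun d => ?_).sub
      ((hmix.tendsto_real hA hC).pow 2)
    congr 1
    ext x
    simp only [Set.mem_inter_iff, Set.mem_preimage, ← Function.iterate_add_apply]
    rw [add_comm d]
    tauto
  have hev : ∀ᶠ d : ℕ in atTop, ∀ i ∈ Finset.Ico 1 L,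
      μ.real ((A ∩ T^[d] ⁻¹' C) ∩ T^[i * (s₀ + 1)] ⁻¹' (A ∩ T^[d] ⁻¹' C)) -
        μ.real (A ∩ T^[d] ⁻¹' C) ^ 2 < ε := by
    rw [eventually_all_finset]
    intro i hi
    refine (hlim i).eventually_lt_const ?_
    have hi1 : 1 ≤ i := (Finset.mem_Ico.1 hi).1
    have := hs₀ (i * (s₀ + 1)) (by nlinarith)
    linarith
  obtain ⟨D, hD⟩ := eventually_atTop.1 hev
  -- For a single d, mixing of A ∩ T⁻ᵈC with itself suffices; this serves the finitely many d < `D`.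
  have hsmall (d : ℕ) : ∃ s : ℕ, ∀ i, 1 ≤ i →
      μ.real ((A ∩ T^[d] ⁻¹' C) ∩ T^[i * s] ⁻¹' (A ∩ T^[d] ⁻¹' C))
        ≤ μ.real (A ∩ T^[d] ⁻¹' C) ^ 2 + ε := by
    obtain ⟨s, hs⟩ := eventually_atTop.1
      ((hmix.tendsto_real (hB d) (hB d)).eventually_lt_const
        (show _ < μ.real (A ∩ T^[d] ⁻¹' C) ^ 2 + ε by nlinarith))
    exact ⟨s, fun i hi => (hs _ (by nlinarith)).le⟩
  choose σ hσ using hsmall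
  refine ⟨(s₀ + 1) + ∑ d ∈ Finset.range D, σ d, fun d => ?_⟩
  rcases lt_or_ge d D with hd | hd
  · exact ⟨σ d, (Finset.single_le_sum (fun _ _ => Nat.zero_le _)
      (Finset.mem_range.2 hd)).trans (Nat.le_add_left _ _), fun i hi _ => hσ d i hi⟩
  · refine ⟨s₀ + 1, Nat.le_add_right _ _, fun i hi hiL => ?_⟩
    linarith [hD d hd i (Finset.mem_Ico.2 ⟨hi, hiL⟩)]

/-- Almost invariant sets are almost independent of the sets `A ∩ T⁻ᵈ C`, uniformly in `d`. -/
theorem IsMixing.exists_uniform_lower_bound (hT : MeasurePreserving T μ μ)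
    (hmix : IsMixing μ T) {A C : Set X} (hA : MeasurableSet A) (hC : MeasurableSet C)
    {η : ℝ} (hη : 0 < η) :
    ∃ κ > 0, ∀ d : ℕ, ∀ W : Set X, MeasurableSet W → μ.real (W \ T ⁻¹' W) ≤ κ →
      μ.real W * μ.real (A ∩ T^[d] ⁻¹' C) - η ≤ μ.real (W ∩ (A ∩ T^[d] ⁻¹' C)) := by
  -- With θ = η/4 and decorrelation error 1/L, the variance term 8/(Lη) is at most η/4; the drift of
  -- `W` and `θ` cost η/4 each.
  obtain ⟨L, hL⟩ := exists_nat_gt (32 / η ^ 2)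
  have hL' : (0 : ℝ) < L := lt_trans (by positivity) hL
  have hL0 : 0 < L := by exact_mod_cast hL'
  obtain ⟨M, hM⟩ := hmix.exists_uniform_decorrelation hT hA hC L
    (show (0 : ℝ) < 1 / L by positivity)
  refine ⟨η / (4 * L * (M + 1)), by positivity, fun d W hW hκ => ?_⟩
  obtain ⟨s, hsM, hs⟩ := hM d
  have h := le_measureReal_inter_of_correlations hT
    (hA.inter ((hT.iterate d).measurable hC)) hW hL0 s (by positivity)
    (show 0 < η / 4 by positivity) hs
  have h1 : (L : ℝ) * s * μ.real (W \ T ⁻¹' W) ≤ η / 4 := by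
    have hsM' : (s : ℝ) ≤ M + 1 := by
      have : (s : ℝ) ≤ M := by exact_mod_cast hsM
      linarith
    calc (L : ℝ) * s * μ.real (W \ T ⁻¹' W) ≤ L * (M + 1) * (η / (4 * L * (M + 1))) := by gcongr
      _ = η / 4 := by field_simp
  have h2 : ((1 : ℝ) / L + 1 / L) / (η / 4) ≤ η / 4 := by
    rw [div_le_iff₀ (by positivity), ← add_div, div_le_iff₀ hL']
    rw [div_lt_iff₀ (by positivity)] at hL
    nlinarith
  linarith

/-- A set of intermediate measure is uniformly displaced by all nontrivial powers of a mixing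
transformation. -/
theorem IsMixing.exists_le_measureReal_inter_preimage_compl (hT : MeasurePreserving T μ μ)
    (hmix : IsMixing μ T) {A : Set X} (hA : MeasurableSet A) (h0 : 0 < μ.real A)
    (h1 : μ.real A < 1) :
    ∃ c > 0, ∀ d : ℕ, 1 ≤ d → c ≤ μ.real (A ∩ T^[d] ⁻¹' Aᶜ) := by
  have hcompl : μ.real Aᶜ = 1 - μ.real A := probReal_compl_eq_one_sub hA
  -- Otherwise `A` is invariant under Tᵈ modulo null sets, and mixing along multiples of d gives
  -- μ(A) = μ(A)².
  have hpos (d : ℕ) (hd : 1 ≤ d) : 0 < μ.real (A ∩ T^[d] ⁻¹' Aᶜ) := by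
    by_contra hcon
    have hz : μ.real (A \ T^[d] ⁻¹' A) = 0 := le_antisymm (not_lt.1 hcon) measureReal_nonneg
    have hit (n : ℕ) : μ.real (A ∩ T^[d * n] ⁻¹' A) = μ.real A := by
      have := measureReal_diff_preimage_iterate_le (hT.iterate d) hA n
      rw [hz, mul_zero, ← Function.iterate_mul] at this
      have h2 := measureReal_inter_add_sdiff (μ := μ) (s := A)
        ((hT.iterate (d * n)).measurable hA)
      linarith [measureReal_nonneg (μ := μ) (s := A \ T^[d * n] ⁻¹' A)]
    have hlim : Tendsto (fun n : ℕ => μ.real (A ∩ T^[d * n] ⁻¹' A)) atTop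
        (𝓝 (μ.real A * μ.real A)) :=
      (hmix.tendsto_real hA hA).comp (tendsto_id.const_mul_atTop' (by omega))
    simp only [hit] at hlim
    have := tendsto_nhds_unique tendsto_const_nhds hlim
    nlinarith
  have hlim := hmix.tendsto_real hA hA.compl
  rw [hcompl] at hlim
  have hp : 0 < μ.real A * (1 - μ.real A) := mul_pos h0 (by linarith)
  obtain ⟨D, hD⟩ := eventually_atTop.1 (hlim.eventually_const_lt (half_lt_self hp))
  have hfin (K : ℕ) : ∃ c > 0, ∀ d : ℕ, 1 ≤ d → d < K → c ≤ μ.real (A ∩ T^[d] ⁻¹' Aᶜ) := by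
    induction K with
    | zero => exact ⟨1, one_pos, fun d _ hd => absurd hd (by omega)⟩
    | succ K ih =>
      obtain ⟨c, hc, h⟩ := ih
      rcases Nat.eq_zero_or_pos K with hK | hK
      · exact ⟨c, hc, fun d hd hdK => by omega⟩
      · refine ⟨min c (μ.real (A ∩ T^[K] ⁻¹' Aᶜ)), lt_min hc (hpos K hK), fun d hd hdK => ?_⟩
        rcases Nat.lt_succ_iff_lt_or_eq.1 hdK with h' | h'
        · exact (min_le_left _ _).trans (h d hd h')
        · exact h' ▸ min_le_right _ _
  obtain ⟨c, hc, h⟩ := hfin D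
  refine ⟨min c (μ.real A * (1 - μ.real A) / 2), lt_min hc (by positivity), fun d hd => ?_⟩
  rcases lt_or_ge d D with h' | h'
  · exact (min_le_left _ _).trans (h d hd h')
  · exact (min_le_right _ _).trans (hD d h').le

end Mixing

/-! ### Small partition elements in the atomless case, and the case of an atom. -/

section NoAtoms

variable {X : Type*} [MeasurableSpace X] {μ : Measure X}

/-- A probability space without atoms has finite covers by sets of small measure. -/
theorem exists_finite_cover_measureReal_lt [StandardBorelSpace X] [IsProbabilityMeasure μ]
    (hμ : ∀ x, μ {x} = 0) {c : ℝ} (hc : 0 < c) :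
    ∃ 𝒬 : Set (Set X), 𝒬.Finite ∧ (∀ Q ∈ 𝒬, MeasurableSet Q ∧ μ.real Q < c) ∧ ⋃₀ 𝒬 = Set.univ := by
  let _ := upgradeStandardBorel X
  have hc' : 0 < ENNReal.ofReal c := ENNReal.ofReal_pos.2 hc
  have hopen (x : X) : ∃ U : Set X, x ∈ U ∧ IsOpen U ∧ μ U < ENNReal.ofReal c := by
    obtain ⟨U, hxU, hU, hlt⟩ := Set.exists_isOpen_lt_of_lt ({x} : Set X) (ENNReal.ofReal c)
      ((hμ x).trans_lt hc')
    exact ⟨U, hxU rfl, hU, hlt⟩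
  choose U hxU hU hlt using hopen
  have hreal {Q : Set X} (h : μ Q < ENNReal.ofReal c) : μ.real Q < c :=
    (ENNReal.lt_ofReal_iff_toReal_lt (measure_ne_top _ _)).1 h
  obtain ⟨s, hs, hcov⟩ := TopologicalSpace.countable_cover_nhds fun x => (hU x).mem_nhds (hxU x)
  have hX : (Set.univ : Set X).Nonempty := (nonempty_of_isProbabilityMeasure μ).elim
    fun x => ⟨x, trivial⟩
  have hsne : s.Nonempty := by
    rw [Set.nonempty_iff_ne_empty]
    rintro rfl
    rw [Set.biUnion_empty] at hcov
    exact hX.ne_empty hcov.symm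
  obtain ⟨f, rfl⟩ := hs.exists_eq_range hsne
  have hcov' : ⋃ n, U (f n) = Set.univ := by rw [← hcov, Set.biUnion_range]
  have hlim := tendsto_measure_iUnion_accumulate (μ := μ) (f := fun n => U (f n))
  rw [hcov', measure_univ] at hlim
  have hacc (n : ℕ) : MeasurableSet (Set.accumulate (fun n => U (f n)) n) :=
    (isOpen_biUnion fun m _ => hU (f m)).measurableSet
  -- Finitely many of the countably many small open sets miss only a small set, which becomes the
  -- last member of the cover.
  have hlim' : Tendsto (fun n => 1 - μ (Set.accumulate (fun n => U (f n)) n)) atTop (𝓝 (1 - 1)) :=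
    ENNReal.Tendsto.sub tendsto_const_nhds hlim (Or.inl ENNReal.one_ne_top)
  rw [tsub_self] at hlim'
  obtain ⟨M, hM⟩ := (hlim'.eventually_lt_const hc').exists
  rw [← prob_compl_eq_one_sub (hacc M)] at hM
  refine ⟨insert (Set.accumulate (fun n => U (f n)) M)ᶜ ((fun n => U (f n)) '' Set.Iic M),
    ((Set.finite_Iic M).image _).insert _, ?_, ?_⟩
  · rintro Q (rfl | ⟨n, -, rfl⟩)
    · exact ⟨(hacc M).compl, hreal hM⟩
    · exact ⟨(hU _).measurableSet, hreal (hlt _)⟩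
  · rw [Set.sUnion_insert, Set.sUnion_image]
    exact Set.compl_union_self _

/-- If a sequence of partitions approximates all measurable sets in a space without atoms then
the elements of the partitions become uniformly small. -/
theorem eventually_measureReal_le_of_approximating [StandardBorelSpace X]
    [IsProbabilityMeasure μ] (hμ : ∀ x, μ {x} = 0) {ξ : ℕ → Set (Set X)}
    (hdisj : ∀ j, (ξ j).PairwiseDisjoint id)
    (happ : ∀ A : Set X, MeasurableSet A → ∀ ε : ℝ, 0 < ε →
      ∀ᶠ j in atTop, ∃ 𝒮 ⊆ ξ j, μ.real (symmDiff A (⋃₀ 𝒮)) < ε) {c : ℝ} (hc : 0 < c) :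
    ∀ᶠ j in atTop, ∀ P ∈ ξ j, μ.real P ≤ c := by
  obtain ⟨𝒬, hfin, hQ, hcov⟩ := exists_finite_cover_measureReal_lt hμ (half_pos hc)
  set K : ℝ := (hfin.toFinset.card : ℝ) with hK
  have hev : ∀ᶠ j in atTop, ∀ Q ∈ 𝒬, ∃ 𝒮 ⊆ ξ j,
      μ.real (symmDiff Q (⋃₀ 𝒮)) < c / (2 * (K + 1)) :=
    (eventually_all_finite hfin).2 fun Q hQ' => happ Q (hQ Q hQ').1 _ (by positivity)
  filter_upwards [hev] with j hj P hP
  -- If `P` is used to approximate some small `Q`, it lies in `Q` up to the error. If it is never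
  -- used, each `P ∩ Q` lies in an error set, and these pieces cover `P`.
  by_cases hcase : ∃ Q ∈ 𝒬, ∃ 𝒮 ⊆ ξ j,
      μ.real (symmDiff Q (⋃₀ 𝒮)) < c / (2 * (K + 1)) ∧ P ∈ 𝒮
  · obtain ⟨Q, hQ', 𝒮, -, hlt, hPS⟩ := hcase
    have hsub : P ⊆ Q ∪ symmDiff Q (⋃₀ 𝒮) := by
      intro x hx
      by_cases hxQ : x ∈ Q
      · exact Or.inl hxQ
      · exact Or.inr (Or.inr ⟨⟨P, hPS, hx⟩, hxQ⟩)
    have h1 := (measureReal_mono (μ := μ) hsub).trans (measureReal_union_le _ _)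
    have h2 : c / (2 * (K + 1)) ≤ c / 2 := by
      have : (0 : ℝ) ≤ K := by positivity
      gcongr
      linarith
    linarith [(hQ Q hQ').2]
  · push Not at hcase
    have hpiece (Q : Set X) (hQ' : Q ∈ hfin.toFinset) : μ.real (P ∩ Q) ≤ c / (2 * (K + 1)) := by
      rw [Set.Finite.mem_toFinset] at hQ'
      obtain ⟨𝒮, hS, hlt⟩ := hj Q hQ'
      refine (measureReal_mono ?_).trans hlt.le
      rintro x ⟨hxP, hxQ⟩
      refine Or.inl ⟨hxQ, ?_⟩
      rintro ⟨P', hP', hxP'⟩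
      have hne : P ≠ P' := fun h => hcase Q hQ' 𝒮 hS hlt (h ▸ hP')
      exact (Set.disjoint_left.1 (hdisj j hP (hS hP') hne)) hxP hxP'
    have hsub : P ⊆ ⋃ Q ∈ hfin.toFinset, P ∩ Q := by
      intro x hx
      obtain ⟨Q, hQ', hxQ⟩ : x ∈ ⋃₀ 𝒬 := hcov ▸ Set.mem_univ x
      exact Set.mem_biUnion (hfin.mem_toFinset.2 hQ') ⟨hx, hxQ⟩
    calc μ.real P ≤ ∑ Q ∈ hfin.toFinset, μ.real (P ∩ Q) :=
          (measureReal_mono hsub (measure_ne_top _ _)).trans (measureReal_biUnion_finset_le _ _)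
      _ ≤ ∑ Q ∈ hfin.toFinset, c / (2 * (K + 1)) := Finset.sum_le_sum hpiece
      _ = K * (c / (2 * (K + 1))) := by rw [Finset.sum_const, nsmul_eq_mul]
      _ ≤ c := by
          have : (0 : ℝ) ≤ K := by positivity
          rw [mul_div_assoc', div_le_iff₀ (by positivity)]
          nlinarith

/-- A mixing transformation of a probability space with an atom lives on a single point. -/
theorem IsMixing.measureReal_singleton_eq_one [MeasurableSingletonClass X]
    [IsProbabilityMeasure μ] {T : X → X} (hmix : IsMixing μ T) {x : X} (hx : μ {x} ≠ 0) :
    μ.real {x} = 1 := by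
  have hp : 0 < μ.real {x} := ENNReal.toReal_pos hx (measure_ne_top _ _)
  have hlim := hmix.tendsto_real (MeasurableSet.singleton x) (MeasurableSet.singleton x)
  obtain ⟨n, hn⟩ := eventually_atTop.1 (hlim.eventually_const_lt (mul_pos hp hp))
  -- A positive correlation of `{x}` with its preimage means that x returns to itself; the
  -- correlations are then eventually μ{x}, with limit μ{x}².
  have hfix (m : ℕ) (hm : n ≤ m) : T^[m] x = x := by
    by_contra hne
    have h0 : {x} ∩ T^[m] ⁻¹' {x} = ∅ := by
      ext y
      simp only [Set.mem_inter_iff, Set.mem_singleton_iff, Set.mem_preimage, Set.mem_empty_iff_false,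
        iff_false, not_and]
      rintro rfl
      exact hne
    have := hn m hm
    rw [h0, measureReal_empty] at this
    exact lt_irrefl _ this
  have hconst : ∀ᶠ m in atTop, μ.real ({x} ∩ T^[m] ⁻¹' {x}) = μ.real {x} := by
    filter_upwards [eventually_ge_atTop n] with m hm
    congr 1
    refine Set.inter_eq_left.2 ?_
    rintro y rfl
    exact hfix m hm
  have := tendsto_nhds_unique (tendsto_const_nhds.congr' (hconst.mono fun _ h => h.symm)) hlim
  nlinarith

end NoAtoms

/-! ### From operators to sets. -/

section WH

variable {X : Type*} [MeasurableSpace X] {μ : Measure X}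

theorem coe_pow_eq_iterate (T : MPEquiv μ) (n : ℕ) : (⇑(T ^ n) : X → X) = (⇑T)^[n] := by
  induction n with
  | zero => rfl
  | succ n ih =>
    rw [pow_succ, Function.iterate_succ, ← ih]
    rfl

/-- Applying the isometry Tⁱ removes the conjugation. For the indicator of `A` the right side
measures how `S` moves T⁻ⁱA. -/
theorem norm_conjOp_sub (T S : Aut μ) (i : ℕ) (f : Lp ℂ 2 μ) :
    ‖conjOp T S i f - f‖ = ‖koopman S (koopman (T ^ i) f) - koopman (T ^ i) f‖ := by
  rw [← LinearIsometry.norm_map (koopman (T ^ i)) (conjOp T S i f - f), map_sub, conjOp,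
    ← koopman_mul (T⁻¹ ^ i), inv_pow, inv_mul_cancel, koopman_one]

theorem norm_sq_indicatorConstLp_sub [IsFiniteMeasure μ] {A B : Set X} (hA : MeasurableSet A)
    (hB : MeasurableSet B) :
    ‖indicatorConstLp 2 hA (measure_ne_top μ A) (1 : ℂ)
      - indicatorConstLp 2 hB (measure_ne_top μ B) (1 : ℂ)‖ ^ 2 = μ.real (symmDiff A B) := by
  rw [← dist_eq_norm, dist_indicatorConstLp_eq_norm,
    norm_indicatorConstLp (by norm_num) (by norm_num), norm_one, one_mul, ← Real.rpow_natCast,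
    ← Real.rpow_mul measureReal_nonneg]
  norm_num

/-- For a weakly homoclinic `S`, the sets `T⁻ⁱA` become `S`-invariant on average. -/
theorem IsWeaklyHomoclinic.tendsto_average_symmDiff [IsFiniteMeasure μ] {T S : MPEquiv μ}
    (h : IsWeaklyHomoclinic (T : Aut μ) (S : Aut μ)) {A : Set X} (hA : MeasurableSet A) :
    Tendsto (fun N : ℕ => (1 / (N : ℝ)) * ∑ i ∈ Finset.Icc 1 N,
      μ.real (symmDiff (S ⁻¹' ((⇑T)^[i] ⁻¹' A)) ((⇑T)^[i] ⁻¹' A))) atTop (𝓝 0) := by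
  refine ((isWeaklyHomoclinic_iff _ _).1 h
    (indicatorConstLp 2 hA (measure_ne_top μ A) (1 : ℂ))).congr fun N => ?_
  congr 1
  refine Finset.sum_congr rfl fun i _ => ?_
  have hm : MeasurableSet ((T ^ i : MPEquiv μ) ⁻¹' A) := (T ^ i).toEquiv.measurable hA
  rw [← coe_pow_eq_iterate, norm_conjOp_sub,
    ← norm_sq_indicatorConstLp_sub (S.toEquiv.measurable hm) hm]
  rfl

/-- A measurable self-map which preserves all measurable sets up to null sets is the identity. -/
theorem ae_eq_id_of_measureReal_symmDiff_eq_zero [StandardBorelSpace X] [IsFiniteMeasure μ]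
    {S : X → X} (h : ∀ B, MeasurableSet B → μ.real (symmDiff (S ⁻¹' B) B) = 0) : S =ᵐ[μ] id := by
  -- In a standard Borel space countably many measurable sets separate points.
  refine EventuallyEq.of_forall_separating_preimage MeasurableSet fun B hB => ?_
  rw [Set.preimage_id, ← measure_symmDiff_eq_zero_iff]
  exact (measureReal_eq_zero_iff (measure_ne_top _ _)).1 (h B hB)

end WH

/-! ### Towers and the counting of mismatches. -/

section Tower

variable {X : Type*} {T : X → X} {E : Set X} {h : ℕ}

theorem towerPartition_pairwiseDisjoint
    (hdisj : ∀ i < h, ∀ k < h, i ≠ k → Disjoint (T^[i] '' E) (T^[k] '' E)) :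
    (towerPartition T E h).PairwiseDisjoint id := by
  have hres {L : Set X} (hL : L ∈ towerLevels T E h) :
      Disjoint L (⋃₀ towerLevels T E h)ᶜ :=
    disjoint_compl_right.mono_left (Set.subset_sUnion_of_mem hL)
  rintro L (⟨i, hi, rfl⟩ | rfl) L' (⟨k, hk, rfl⟩ | rfl) hne
  · exact hdisj i hi k hk fun h => hne (h ▸ rfl)
  · exact hres ⟨i, hi, rfl⟩
  · exact (hres ⟨k, hk, rfl⟩).symm
  · exact absurd rfl hne

/-- Disjoint atoms make a union of atoms constant on each level; the residual atom may belong to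
`𝒮`, as only behaviour on levels matters. -/
theorem mem_sUnion_iff_of_mem_level
    (hdisj : ∀ i < h, ∀ k < h, i ≠ k → Disjoint (T^[i] '' E) (T^[k] '' E))
    {𝒮 : Set (Set X)} (hS : 𝒮 ⊆ towerPartition T E h) {i : ℕ} (hi : i < h) {x y : X}
    (hx : x ∈ T^[i] '' E) (hy : y ∈ T^[i] '' E) : x ∈ ⋃₀ 𝒮 ↔ y ∈ ⋃₀ 𝒮 := by
  have key {x y : X} (hx : x ∈ T^[i] '' E) (hy : y ∈ T^[i] '' E) (hxS : x ∈ ⋃₀ 𝒮) :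
      y ∈ ⋃₀ 𝒮 := by
    obtain ⟨L, hL, hxL⟩ := hxS
    have : L = T^[i] '' E := (towerPartition_pairwiseDisjoint hdisj).elim_set (hS hL)
      (Or.inl ⟨i, hi, rfl⟩) x hxL hx
    exact ⟨L, hL, this ▸ hy⟩
  exact ⟨key hx hy, key hy hx⟩

theorem iterate_add_mem_image {k n : ℕ} {x : X} (hx : x ∈ T^[k] '' E) :
    T^[n] x ∈ T^[k + n] '' E := by
  obtain ⟨y, hy, rfl⟩ := hx
  exact ⟨y, hy, by rw [add_comm, Function.iterate_add_apply]⟩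

open scoped Classical in
/-- The number of times `1 ≤ n ≤ N` at which the orbits of `x` and `y` are on different sides
of `A`. -/
noncomputable def mismatches (T : X → X) (A : Set X) (N : ℕ) (x y : X) : ℕ :=
  {n ∈ Finset.Icc 1 N | ¬(T^[n] x ∈ A ↔ T^[n] y ∈ A)}.card

theorem mismatches_comm (A : Set X) (N : ℕ) (x y : X) :
    mismatches T A N x y = mismatches T A N y x := by
  unfold mismatches
  congr 2
  funext n
  rw [iff_comm]

variable [MeasurableSpace X] {μ : Measure X}

theorem measurableSet_iterate_image (hTe : MeasurableEmbedding T) (hE : MeasurableSet E) (n : ℕ) :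
    MeasurableSet (T^[n] '' E) := by
  induction n with
  | zero => simpa using hE
  | succ n ih =>
    rw [Function.iterate_succ', Set.image_comp]
    exact hTe.measurableSet_image.2 ih

theorem measureReal_iterate_image (hT : MeasurePreserving T μ μ) (hTe : MeasurableEmbedding T)
    (hE : MeasurableSet E) (n : ℕ) : μ.real (T^[n] '' E) = μ.real E := by
  rw [← measureReal_preimage_iterate hT (measurableSet_iterate_image hTe hE n) n,
    Set.preimage_image_eq _ (hTe.injective.iterate n)]

theorem measurableSet_of_mem_towerPartition (hTe : MeasurableEmbedding T) (hE : MeasurableSet E)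
    {L : Set X} (hL : L ∈ towerPartition T E h) : MeasurableSet L := by
  rcases hL with ⟨i, -, rfl⟩ | rfl
  · exact measurableSet_iterate_image hTe hE i
  · refine (MeasurableSet.sUnion ?_ ?_).compl
    · exact ((Set.finite_Iio h).image fun i => T^[i] '' E).countable.mono
        (by rintro L ⟨i, hi, rfl⟩; exact ⟨i, hi, rfl⟩)
    · rintro L ⟨i, -, rfl⟩
      exact measurableSet_iterate_image hTe hE i

theorem measurableSet_sUnion_of_subset_towerPartition (hTe : MeasurableEmbedding T)
    (hE : MeasurableSet E) {𝒮 : Set (Set X)} (hS : 𝒮 ⊆ towerPartition T E h) :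
    MeasurableSet (⋃₀ 𝒮) := by
  refine MeasurableSet.sUnion (Set.Countable.mono hS ?_)
    fun L hL => measurableSet_of_mem_towerPartition hTe hE (hS hL)
  refine (((Set.finite_Iio h).image fun i => T^[i] '' E).countable.mono ?_).union
    (Set.countable_singleton _)
  rintro L ⟨i, hi, hL⟩
  exact ⟨i, hi, hL.symm⟩

theorem measureReal_biUnion_levels [IsFiniteMeasure μ] (hT : MeasurePreserving T μ μ)
    (hTe : MeasurableEmbedding T) (hE : MeasurableSet E)
    (hdisj : ∀ i < h, ∀ k < h, i ≠ k → Disjoint (T^[i] '' E) (T^[k] '' E))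
    (s : Finset ℕ) (hs : ∀ i ∈ s, i < h) :
    μ.real (⋃ i ∈ s, T^[i] '' E) = s.card * μ.real E := by
  rw [measureReal_biUnion_finset (fun i hi k hk hne => hdisj i (hs i hi) k (hs k hk) hne)
    (fun i _ => measurableSet_iterate_image hTe hE i),
    Finset.sum_congr rfl fun i _ => measureReal_iterate_image hT hTe hE i, Finset.sum_const,
    nsmul_eq_mul]

/-- Mixing bounds are available for a fixed `A`, counting needs an approximant `A'` constant on
levels. Passing between them costs one symmetric difference at time 0 and one at time d. -/
theorem measureReal_inter_inter_preimage_compl_le [IsFiniteMeasure μ]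
    (hT : MeasurePreserving T μ μ) {A A' : Set X} (hA : MeasurableSet A) (hA' : MeasurableSet A')
    (W : Set X) (d : ℕ) :
    μ.real (W ∩ (A ∩ T^[d] ⁻¹' Aᶜ)) ≤ μ.real (W ∩ (A' ∩ T^[d] ⁻¹' A'ᶜ))
      + 2 * μ.real (symmDiff A A') := by
  have hsub : W ∩ (A ∩ T^[d] ⁻¹' Aᶜ) ⊆ W ∩ (A' ∩ T^[d] ⁻¹' A'ᶜ) ∪
      (symmDiff A A' ∪ T^[d] ⁻¹' (symmDiff A A')) := by
    rintro x ⟨hW, hxA, hxd⟩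
    by_cases h1 : x ∈ A'
    · by_cases h2 : T^[d] x ∈ A'
      · exact Or.inr (Or.inr (Or.inr ⟨h2, hxd⟩))
      · exact Or.inl ⟨hW, h1, h2⟩
    · exact Or.inr (Or.inl (Or.inl ⟨hxA, h1⟩))
  have h1 := (measureReal_mono (μ := μ) hsub).trans (measureReal_union_le _ _)
  have h2 := measureReal_union_le (μ := μ) (symmDiff A A') (T^[d] ⁻¹' (symmDiff A A'))
  rw [measureReal_preimage_iterate hT (hA.symmDiff hA')] at h2
  linarith

/-- Two points in different levels of a tower, far from its top, have orbits which disagree about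
a union of levels as often as is forced by the displacement of that set. -/
theorem le_mismatches_mul_of_lt [IsFiniteMeasure μ] (hT : MeasurePreserving T μ μ)
    (hTe : MeasurableEmbedding T) (hE : MeasurableSet E)
    (hdisj : ∀ i < h, ∀ k < h, i ≠ k → Disjoint (T^[i] '' E) (T^[k] '' E))
    {A A' : Set X} (hA : MeasurableSet A) (hA' : MeasurableSet A')
    (hlev : ∀ i < h, ∀ x ∈ T^[i] '' E, ∀ y ∈ T^[i] '' E, x ∈ A' → y ∈ A')
    {c η κ : ℝ} (hc : ∀ d : ℕ, 1 ≤ d → c ≤ μ.real (A ∩ T^[d] ⁻¹' Aᶜ))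
    (hκ : ∀ d : ℕ, ∀ W : Set X, MeasurableSet W → μ.real (W \ T ⁻¹' W) ≤ κ →
      μ.real W * μ.real (A ∩ T^[d] ⁻¹' Aᶜ) - η ≤ μ.real (W ∩ (A ∩ T^[d] ⁻¹' Aᶜ)))
    (hEκ : μ.real E ≤ κ) {N k l : ℕ} (hkl : k < l) (hlN : l + N < h)
    {x y : X} (hx : x ∈ T^[k] '' E) (hy : y ∈ T^[l] '' E) :
    N * μ.real E * c - η - 2 * μ.real (symmDiff A A')
      ≤ mismatches T A' N x y * μ.real E := by
  classical
  -- The levels visited by x at times 1, …, N.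
  set W : Set X := ⋃ n ∈ Finset.Icc (k + 1) (k + N), T^[n] '' E with hW
  have hWm : MeasurableSet W :=
    Finset.measurableSet_biUnion _ fun n _ => measurableSet_iterate_image hTe hE n
  have hWμ : μ.real W = N * μ.real E := by
    rw [hW, measureReal_biUnion_levels hT hTe hE hdisj _
      (fun i hi => by rw [Finset.mem_Icc] at hi; omega), Nat.card_Icc]
    congr 2
    omega
  have hWT : μ.real (W \ T ⁻¹' W) ≤ κ := by
    refine le_trans (measureReal_mono ?_) ((measureReal_iterate_image hT hTe hE (k + N)).trans_le hEκ)
    rintro z ⟨hz, hz'⟩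
    simp only [hW, Set.mem_iUnion, Finset.mem_Icc, Set.mem_preimage, exists_prop, not_exists,
      not_and] at hz hz'
    obtain ⟨n, hn, hzn⟩ := hz
    rcases hn.2.lt_or_eq with h1 | h1
    · exact absurd (iterate_add_mem_image (n := 1) hzn) (hz' (n + 1) ⟨by omega, by omega⟩)
    · exact h1 ▸ hzn
  have h1 := hκ (l - k) W hWm hWT
  have h2 := measureReal_inter_inter_preimage_compl_le hT hA hA' W (l - k)
  have h3 : μ.real (W ∩ (A' ∩ T^[l - k] ⁻¹' A'ᶜ)) ≤ mismatches T A' N x y * μ.real E := by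
    -- If z is in level k + n, it shares its level with Tⁿx, and Tˡ⁻ᵏz shares its level with Tⁿy. So
    -- z witnesses a mismatch at time n, and each mismatch accounts for one level.
    have hsub : W ∩ (A' ∩ T^[l - k] ⁻¹' A'ᶜ) ⊆
        ⋃ n ∈ {n ∈ Finset.Icc 1 N | ¬(T^[n] x ∈ A' ↔ T^[n] y ∈ A')}, T^[k + n] '' E := by
      rintro z ⟨hzW, hzA, hzd⟩
      simp only [hW, Set.mem_iUnion, Finset.mem_Icc, exists_prop] at hzW
      obtain ⟨m, hm, hzm⟩ := hzW
      obtain ⟨n, rfl⟩ := Nat.exists_eq_add_of_le (show k ≤ m by omega)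
      have hxA : T^[n] x ∈ A' :=
        hlev (k + n) (by omega) z hzm _ (iterate_add_mem_image hx) hzA
      have hzl : T^[l - k] z ∈ T^[l + n] '' E := by
        have := iterate_add_mem_image (n := l - k) hzm
        rwa [show k + n + (l - k) = l + n by omega] at this
      have hyA : T^[n] y ∉ A' := fun hcon =>
        hzd (hlev (l + n) (by omega) _ (iterate_add_mem_image hy) _ hzl hcon)
      simp only [Set.mem_iUnion, Finset.mem_filter, Finset.mem_Icc, exists_prop]
      exact ⟨n, ⟨⟨by omega, by omega⟩, fun hiff => hyA (hiff.1 hxA)⟩, hzm⟩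
    refine ((measureReal_mono hsub (measure_ne_top _ _)).trans (measureReal_biUnion_finset_le _ _)).trans_eq ?_
    rw [Finset.sum_congr rfl fun n _ => measureReal_iterate_image hT hTe hE (k + n),
      Finset.sum_const, nsmul_eq_mul, mismatches]
  have h4 : μ.real W * c ≤ μ.real W * μ.real (A ∩ T^[l - k] ⁻¹' Aᶜ) :=
    mul_le_mul_of_nonneg_left (hc _ (by omega)) measureReal_nonneg
  rw [hWμ] at h1 h4
  linarith

/-- Markov's inequality for the number of mismatches along the orbits of `x` and `S x`. -/
theorem mul_measureReal_le_mismatches [IsFiniteMeasure μ] (hT : MeasurePreserving T μ μ)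
    {S : X → X} (hS : MeasurePreserving S μ μ) {A A' : Set X} (hA : MeasurableSet A)
    (hA' : MeasurableSet A') (N : ℕ) (t : ℝ) :
    t * μ.real {x | t ≤ mismatches T A' N x (S x)} ≤
      ∑ n ∈ Finset.Icc 1 N, μ.real (symmDiff (S ⁻¹' (T^[n] ⁻¹' A)) (T^[n] ⁻¹' A))
        + N * (2 * μ.real (symmDiff A A')) := by
  classical
  have hp (n : ℕ) {D : Set X} (hD : MeasurableSet D) : MeasurableSet (T^[n] ⁻¹' D) :=
    (hT.iterate n).measurable hD
  have hD (n : ℕ) : MeasurableSet (symmDiff (S ⁻¹' (T^[n] ⁻¹' A')) (T^[n] ⁻¹' A')) :=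
    (hS.measurable (hp n hA')).symmDiff (hp n hA')
  have hi (n : ℕ) : Integrable
      ((symmDiff (S ⁻¹' (T^[n] ⁻¹' A')) (T^[n] ⁻¹' A')).indicator (1 : X → ℝ)) μ :=
    (integrable_const (1 : ℝ)).indicator (hD n)
  have hcount (x : X) : (mismatches T A' N x (S x) : ℝ) = ∑ n ∈ Finset.Icc 1 N,
      (symmDiff (S ⁻¹' (T^[n] ⁻¹' A')) (T^[n] ⁻¹' A')).indicator (1 : X → ℝ) x := by
    rw [mismatches, Finset.card_filter]
    push_cast
    refine Finset.sum_congr rfl fun n _ => ?_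
    rw [Set.indicator_apply]
    refine if_congr ?_ rfl rfl
    simp only [Set.mem_symmDiff, Set.mem_preimage]
    tauto
  have hmarkov := mul_meas_ge_le_integral_of_nonneg (μ := μ)
    (f := fun x => (mismatches T A' N x (S x) : ℝ)) (Eventually.of_forall fun x => by positivity)
    (by simp only [hcount]; exact integrable_finsetSum _ fun n _ => hi n) t
  refine hmarkov.trans ?_
  simp only [hcount]
  rw [integral_finsetSum _ fun n _ => hi n]
  have hN : (N : ℝ) * (2 * μ.real (symmDiff A A'))
      = ∑ n ∈ Finset.Icc 1 N, 2 * μ.real (symmDiff A A') := by simp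
  rw [hN, ← Finset.sum_add_distrib]
  refine Finset.sum_le_sum fun n _ => ?_
  rw [integral_indicator_one (hD n)]
  -- Replacing `A'` by `A` costs one symmetric difference at Tⁿx and one at TⁿSx.
  have hsub : symmDiff (S ⁻¹' (T^[n] ⁻¹' A')) (T^[n] ⁻¹' A') ⊆
      symmDiff (S ⁻¹' (T^[n] ⁻¹' A)) (T^[n] ⁻¹' A) ∪
        (S ⁻¹' (T^[n] ⁻¹' (symmDiff A A')) ∪ T^[n] ⁻¹' (symmDiff A A')) := by
    intro x
    simp only [Set.mem_symmDiff, Set.mem_union, Set.mem_preimage]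
    tauto
  have h1 := (measureReal_mono (μ := μ) hsub).trans (measureReal_union_le _ _)
  have h2 := measureReal_union_le (μ := μ) (S ⁻¹' (T^[n] ⁻¹' (symmDiff A A')))
    (T^[n] ⁻¹' (symmDiff A A'))
  have hAA := hA.symmDiff hA'
  rw [hS.measureReal_preimage (hp n hAA).nullMeasurableSet,
    measureReal_preimage_iterate hT hAA] at h2
  linarith

/-- If `S` keeps most points in their level of the tower, then it almost preserves sets which are
well approximated by unions of levels. -/
theorem measureReal_symmDiff_preimage_le [IsProbabilityMeasure μ] (hT : MeasurePreserving T μ μ)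
    (hTe : MeasurableEmbedding T) (hE : MeasurableSet E)
    (hdisj : ∀ i < h, ∀ k < h, i ≠ k → Disjoint (T^[i] '' E) (T^[k] '' E))
    {S : X → X} (hS : MeasurePreserving S μ μ) {B B' Z : Set X} (hB : MeasurableSet B)
    (hB' : MeasurableSet B')
    (hlev : ∀ i < h, ∀ x ∈ T^[i] '' E, ∀ y ∈ T^[i] '' E, x ∈ B' → y ∈ B') {m : ℕ} (hm : m ≤ h)
    (hZ : ∀ k < m, ∀ l < m, k ≠ l → ∀ x, x ∈ T^[k] '' E → S x ∈ T^[l] '' E → x ∈ Z) :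
    μ.real (symmDiff (S ⁻¹' B) B) ≤
      2 * μ.real (symmDiff B B') + 2 * (1 - m * μ.real E) + μ.real Z := by
  set G : Set X := ⋃ i ∈ Finset.range m, T^[i] '' E with hG
  have hGm : MeasurableSet G :=
    Finset.measurableSet_biUnion _ fun n _ => measurableSet_iterate_image hTe hE n
  have hGμ : μ.real Gᶜ = 1 - m * μ.real E := by
    rw [probReal_compl_eq_one_sub hGm, hG, measureReal_biUnion_levels hT hTe hE hdisj _
      (fun i hi => (Finset.mem_range.1 hi).trans_le hm), Finset.card_range]
  -- If x and Sx both lie in the lowest m levels and x ∉ `Z`, they share a level, so `B'` cannot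
  -- separate them.
  have hsub : symmDiff (S ⁻¹' B) B ⊆
      ((S ⁻¹' (symmDiff B B') ∪ symmDiff B B') ∪ (S ⁻¹' Gᶜ ∪ Gᶜ)) ∪ Z := by
    intro x hx
    by_contra hcon
    simp only [Set.mem_union, Set.mem_preimage, Set.mem_compl_iff, not_or, not_not] at hcon
    obtain ⟨⟨⟨h1, h2⟩, h3, h4⟩, h5⟩ := hcon
    simp only [hG, Set.mem_iUnion, Finset.mem_range, exists_prop] at h3 h4
    obtain ⟨l, hl, hSx⟩ := h3
    obtain ⟨k, hk, hxk⟩ := h4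
    have hkl : k = l := by
      by_contra hne
      exact h5 (hZ k hk l hl hne x hxk hSx)
    subst hkl
    have h6 := hlev k (hk.trans_le hm) x hxk (S x) hSx
    have h7 := hlev k (hk.trans_le hm) (S x) hSx x hxk
    simp only [Set.mem_symmDiff, Set.mem_preimage] at h1 h2 hx
    tauto
  have e1 := (measureReal_mono (μ := μ) hsub).trans (measureReal_union_le _ _)
  have e2 := measureReal_union_le (μ := μ) (S ⁻¹' (symmDiff B B') ∪ symmDiff B B') (S ⁻¹' Gᶜ ∪ Gᶜ)
  have e3 := measureReal_union_le (μ := μ) (S ⁻¹' (symmDiff B B')) (symmDiff B B')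
  have e4 := measureReal_union_le (μ := μ) (S ⁻¹' Gᶜ) Gᶜ
  rw [hS.measureReal_preimage (hB.symmDiff hB').nullMeasurableSet] at e3
  rw [hS.measureReal_preimage hGm.compl.nullMeasurableSet, hGμ] at e4
  linarith

end Tower

/-! ### Assembling the argument. -/

section Main

variable {X : Type*} [MeasurableSpace X] {μ : Measure X}

theorem eventually_approximation_real [IsFiniteMeasure μ] {ξ : ℕ → Set (Set X)} {A : Set X}
    (happ : ∀ ε : ENNReal, 0 < ε → ∀ᶠ j in atTop, ∃ 𝒮 ⊆ ξ j, μ (symmDiff A (⋃₀ 𝒮)) < ε)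
    {ε : ℝ} (hε : 0 < ε) :
    ∀ᶠ j in atTop, ∃ 𝒮 ⊆ ξ j, μ.real (symmDiff A (⋃₀ 𝒮)) < ε := by
  filter_upwards [happ (ENNReal.ofReal ε) (ENNReal.ofReal_pos.2 hε)] with j ⟨𝒮, hS, hlt⟩
  exact ⟨𝒮, hS, (ENNReal.lt_ofReal_iff_toReal_lt (measure_ne_top _ _)).1 hlt⟩

theorem one_sub_measureReal_compl_sUnion_towerLevels [IsProbabilityMeasure μ] {T : X → X}
    {E : Set X} {h : ℕ} (hT : MeasurePreserving T μ μ) (hTe : MeasurableEmbedding T)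
    (hE : MeasurableSet E)
    (hdisj : ∀ i < h, ∀ k < h, i ≠ k → Disjoint (T^[i] '' E) (T^[k] '' E)) :
    1 - μ.real (⋃₀ towerLevels T E h)ᶜ = h * μ.real E := by
  have hU : ⋃₀ towerLevels T E h = ⋃ i ∈ Finset.range h, T^[i] '' E := by
    ext x
    simp [towerLevels]
  have hm : MeasurableSet (⋃ i ∈ Finset.range h, T^[i] '' E) :=
    Finset.measurableSet_biUnion _ fun n _ => measurableSet_iterate_image hTe hE n
  rw [hU, probReal_compl_eq_one_sub hm, measureReal_biUnion_levels hT hTe hE hdisj _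
    (fun i hi => Finset.mem_range.1 hi), Finset.card_range]
  ring

/-- In a space without atoms, a weakly homoclinic transformation of a mixing rank one
transformation is the identity. -/
theorem IsWeaklyHomoclinic.ae_eq_id [StandardBorelSpace X] [IsProbabilityMeasure μ]
    {T S : MPEquiv μ} (hmix : IsMixing μ T) (hrank : HasRankOne μ T) (hμ : ∀ x, μ {x} = 0)
    (hS : IsWeaklyHomoclinic (T : Aut μ) (S : Aut μ)) : (S : X → X) =ᵐ[μ] id := by
  obtain ⟨E, h, hE, hh, hdisj, happ⟩ := hrank
  have hT := T.preserves
  have hTe : MeasurableEmbedding T := T.toEquiv.measurableEmbedding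
  have happ' (A : Set X) (hA : MeasurableSet A) (ε : ℝ) (hε : 0 < ε) :=
    eventually_approximation_real (happ A hA (measure_lt_top μ A)) hε
  have hsmall {c : ℝ} (hc : 0 < c) : ∀ᶠ j in atTop, μ.real (E j) ≤ c ∧
      1 - c ≤ h j * μ.real (E j) := by
    filter_upwards [eventually_measureReal_le_of_approximating hμ
      (fun j => towerPartition_pairwiseDisjoint (hdisj j)) happ' hc] with j hj
    have h1 := hj _ (Or.inl ⟨0, hh j, rfl⟩)
    have h2 := hj _ (Or.inr rfl)
    rw [Function.iterate_zero, Set.image_id] at h1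
    have h3 := one_sub_measureReal_compl_sUnion_towerLevels hT hTe (hE j) (hdisj j)
    exact ⟨h1, by linarith⟩
  -- The base of a fine enough tower has intermediate measure.
  obtain ⟨A, hA, hA0, hA1⟩ : ∃ A : Set X, MeasurableSet A ∧ 0 < μ.real A ∧ μ.real A < 1 := by
    obtain ⟨j, h1, h2⟩ := (hsmall (show (0 : ℝ) < 1 / 2 by norm_num)).exists
    refine ⟨E j, hE j, lt_of_le_of_ne measureReal_nonneg fun h0 => ?_, by linarith⟩
    rw [← h0] at h2
    norm_num at h2
  obtain ⟨c, hc, hcd⟩ := hmix.exists_le_measureReal_inter_preimage_compl hT hA hA0 hA1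
  refine ae_eq_id_of_measureReal_symmDiff_eq_zero fun B hB => ?_
  have hmain {δ : ℝ} (hδ : 0 < δ) (hδ1 : δ ≤ 1 / 2) : μ.real (symmDiff (S ⁻¹' B) B) ≤ 9 * δ := by
    have hδc : 0 < δ * c := mul_pos hδ hc
    obtain ⟨κ, hκ, hW⟩ := hmix.exists_uniform_lower_bound hT hA hA.compl
      (show 0 < δ * c / 16 by positivity)
    obtain ⟨N₀, hN₀⟩ := eventually_atTop.1 ((hS.tendsto_average_symmDiff hA).eventually_lt_const
      (show 0 < δ * c / 4 by positivity))
    -- The tower is chosen after `κ` and `N₀`. Levels of measure at most δ/(2(N₀+1)) force `N₀ < N`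
    -- below.
    obtain ⟨j, ⟨⟨⟨hj1, hj2⟩, hj3, -⟩, hj4, -⟩, ⟨𝒮, h𝒮, hAS⟩, ℛ, hℛ, hBR⟩ :=
      ((((hsmall hδ).and (hsmall hκ)).and
        (hsmall (show 0 < δ / (2 * (N₀ + 1)) by positivity))).and
        ((happ' A hA _ (show 0 < δ * c / 32 by positivity)).and
          (happ' B hB _ hδ))).exists
    set e := μ.real (E j) with he
    have hhe : 1 / 2 ≤ h j * e := by linarith
    have he0 : 0 < e := by
      refine lt_of_le_of_ne measureReal_nonneg fun h0 => ?_
      rw [← h0] at hhe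
      norm_num at hhe
    -- Blocks of `N` levels have measure at least δ/2, enough to absorb the error δc/16, while
    -- losing the top `N` levels costs at most 2δ.
    set N : ℕ := ⌈δ * h j⌉₊ with hN
    have hN1 : δ * h j ≤ N := Nat.le_ceil _
    have hN2 : (N : ℝ) < δ * h j + 1 := Nat.ceil_lt_add_one (by positivity)
    have hNe : δ / 2 ≤ N * e := by nlinarith
    have hNN : N₀ < N := by
      rw [le_div_iff₀ (by positivity)] at hj4
      have h1 : (N₀ + 1 : ℝ) * e ≤ N * e := by linarith
      have h2 : (N₀ + 1 : ℝ) ≤ N := le_of_mul_le_mul_right h1 he0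
      exact_mod_cast h2
    have hNpos : (0 : ℝ) < N := by exact_mod_cast (Nat.zero_le _).trans_lt hNN
    set A' := ⋃₀ 𝒮 with hA'
    have hA'm : MeasurableSet A' := measurableSet_sUnion_of_subset_towerPartition hTe (hE j) h𝒮
    have hcount {k l : ℕ} (hkl : k < l) (hlN : l + N < h j) {x y : X}
        (hx : x ∈ (⇑T)^[k] '' E j) (hy : y ∈ (⇑T)^[l] '' E j) :
        N * c / 2 ≤ mismatches T A' N x y := by
      have h1 := le_mismatches_mul_of_lt hT hTe (hE j) (hdisj j) hA hA'm
        (fun i hi x hx y hy => (mem_sUnion_iff_of_mem_level (hdisj j) h𝒮 hi hx hy).1)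
        hcd hW hj3 hkl hlN hx hy
      -- The errors δc/16 + 2·δc/32 = δc/8 are at most Nec/4, since Ne ≥ δ/2.
      refine le_of_mul_le_mul_right ?_ he0
      nlinarith
    have hZμ := mul_measureReal_le_mismatches hT S.preserves hA hA'm N (N * c / 2)
    have hw := hN₀ N hNN.le
    rw [one_div, inv_mul_lt_iff₀ hNpos] at hw
    -- The expected number of mismatches is below Nδc/4 + Nδc/16 < Nδc/2.
    have hZδ : μ.real {x | (N * c / 2 : ℝ) ≤ mismatches T A' N x (S x)} ≤ δ := by
      refine le_of_mul_le_mul_left ?_ (show (0 : ℝ) < N * c / 2 by positivity)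
      have h1 : (N : ℝ) * (2 * μ.real (symmDiff A A')) ≤ N * (2 * (δ * c / 32)) := by gcongr
      nlinarith [mul_pos hNpos hδc]
    have hfin := measureReal_symmDiff_preimage_le (m := h j - N)
      (Z := {x | (N * c / 2 : ℝ) ≤ mismatches T A' N x (S x)}) hT hTe (hE j) (hdisj j)
      S.preserves hB (measurableSet_sUnion_of_subset_towerPartition hTe (hE j) hℛ)
      (fun i hi x hx y hy => (mem_sUnion_iff_of_mem_level (hdisj j) hℛ hi hx hy).1)
      (Nat.sub_le _ _) (by
        intro k hk l hl hne x hx hSx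
        rcases hne.lt_or_gt with hlt | hlt
        · exact hcount hlt (by omega) hx hSx
        · rw [Set.mem_ofPred_eq, mismatches_comm]
          exact hcount hlt (by omega) hSx hx)
    have hsub : (h j : ℝ) - N ≤ ((h j - N : ℕ) : ℝ) := by
      rw [sub_le_iff_le_add]
      exact_mod_cast le_tsub_add
    have h5 : ((h j : ℝ) - N) * e ≤ ((h j - N : ℕ) : ℝ) * e := by gcongr
    have h6 : (N : ℝ) * e ≤ δ * (h j * e) + e := by nlinarith
    have h7 : h j * e ≤ 1 := by
      have := one_sub_measureReal_compl_sUnion_towerLevels hT hTe (hE j) (hdisj j)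
      linarith [measureReal_nonneg (μ := μ) (s := (⋃₀ towerLevels T (E j) (h j))ᶜ)]
    -- The lower h − N levels miss at most 3δ, so the total is 2δ + 6δ + δ.
    nlinarith
  refine le_antisymm (le_of_forall_pos_le_add fun ε hε => ?_) measureReal_nonneg
  have := hmain (δ := min (ε / 9) (1 / 2)) (by positivity) (min_le_right _ _)
  linarith [min_le_left (ε / 9) (1 / 2 : ℝ)]

theorem ae_eq_id_of_measureReal_singleton_eq_one [MeasurableSingletonClass X]
    [IsProbabilityMeasure μ] (S : MPEquiv μ) {x : X} (hx : μ.real {x} = 1) :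
    (S : X → X) =ᵐ[μ] id := by
  have hfix : S x = x := by
    have h1 : μ.real (S ⁻¹' {x}) = 1 := by
      rw [S.preserves.measureReal_preimage (MeasurableSet.singleton x).nullMeasurableSet, hx]
    by_contra hne
    have hd : Disjoint ({x} : Set X) (S ⁻¹' {x}) := by
      rw [Set.disjoint_singleton_left]
      exact hne
    have h2 := measureReal_union (μ := μ) hd (S.toEquiv.measurable (MeasurableSet.singleton x))
    rw [hx, h1] at h2
    linarith [measureReal_le_one (μ := μ) (s := {x} ∪ S ⁻¹' {x})]
  have hae : ∀ᵐ y ∂μ, y ∈ ({x} : Set X) := 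
    (mem_ae_iff_prob_eq_one (MeasurableSet.singleton x)).2 ((ENNReal.toReal_eq_one_iff _).1 hx)
  filter_upwards [hae] with y hy
  rw [Set.mem_singleton_iff.1 hy]
  exact hfix

end Main

end RankOne

theorem mainTheorem2 {X : Type*} [MeasurableSpace X] [StandardBorelSpace X]
    (μ : Measure X) [IsProbabilityMeasure μ] (T : RankOne.MPEquiv μ)
    (hmix : RankOne.IsMixing μ T) (hrank : RankOne.HasRankOne μ T) :
    RankOne.WH (T : RankOne.Aut μ) = ⊥ := by
  rw [eq_bot_iff]
  intro S hS
  induction S using Con.induction_on with | H S => ?_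
  refine Subgroup.mem_bot.2 ((Con.eq _).2 ?_)
  change (S : X → X) =ᵐ[μ] id
  -- A standard probability space may have atoms; mixing then puts all mass on one point, and every
  -- automorphism is trivial.
  by_cases hμ : ∀ x, μ {x} = 0
  · exact RankOne.IsWeaklyHomoclinic.ae_eq_id hmix hrank hμ hS
  · push Not at hμ
    obtain ⟨x, hx⟩ := hμ
    exact RankOne.ae_eq_id_of_measureReal_singleton_eq_one S (hmix.measureReal_singleton_eq_one hx)
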